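/- Let $A$ be a commutative pro-$C^*$-algebra, that is, a commutative complete Hausdorff complex topological $*$-algebra (not necessarily unital) whose topology is determined by the set $S(A)$ of its continuous $C^*$-seminorms, and let $E$ be a Hilbert $A$-bimodule: a complex vector space that is both a left and a right Hilbert $A$-module, with left and right $A$-valued inner products ${}_A\langle\cdot,\cdot\rangle$ and $\langle\cdot,\cdot\rangle_A$ (each module being complete for the corresponding seminorms ${}^A\bar p(x)=\sqrt{p({}_A\langle x,x\rangle)}$, respectively $\bar p^A(x)=\sqrt{p(\langle x,x\rangle_A)}$, $p\in S(A)$), such that ${}_A\langle x,y\rangle z=x\langle y,z\rangle_A$ for all $x,y,z\in E$, and $\bar p^A(ax)\le p(a)\,\bar p^A(x)$ and ${}^A\bar p(xa)\le {}^A\bar p(x)\,p(a)$ for all $x\in E$, $a\in A$, $p\in S(A)$. Let $L_A(E)$ be the algebra of bounded adjointable right $A$-module maps on $E$, with the topology defined by the seminorms $\tilde p(T)=\sup\{\bar p^A(Tx): x\in E,\ \bar p^A(x)\le 1\}$, $p\in S(A)$, and let $K_A(E)$ be the closure in $L_A(E)$ of the linear span of the operators $\theta_{x,y}(\xi)=x\langle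 y,\xi\rangle_A$, $x,y\in E$. Then every derivation on $K_A(E)$, i.e. every linear map $D:K_A(E)\to K_A(E)$ with $D(ST)=D(S)T+SD(T)$ for all $S,T\in K_A(E)$ (continuity is not assumed), is zero. -/

import Mathlib

namespace ProCStar

section Definitions

variable (A : Type*) [NonUnitalRing A] [StarRing A] [Module ℂ A]
  [IsScalarTower ℂ A A] [SMulCommClass ℂ A A] [StarModule ℂ A]

/-- A continuous C*-seminorm on a complex topological *-algebra. The invariance
`p (star a) = p a` follows from the fields, see `ContCStarSeminorm.map_star`. -/
structure ContCStarSeminorm [TopologicalSpace A] extends Seminorm ℂ A where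
  continuous' : Continuous toFun
  mul_le' : ∀ a b : A, toFun (a * b) ≤ toFun a * toFun b
  star_mul_self' : ∀ a : A, toFun (star a * a) = toFun a ^ 2

noncomputable instance [TopologicalSpace A] : CoeFun (ContCStarSeminorm A) (fun _ => A → ℝ) :=
  ⟨fun p => p.toSeminorm⟩

/-- A pro-C*-algebra: a complete Hausdorff complex topological *-algebra in which a net (filter)
converges to `0` iff its image under every continuous C*-seminorm converges to `0`. -/
class ProCStarAlgebra [UniformSpace A] : Prop extends IsUniformAddGroup A, ContinuousMul A,
    ContinuousStar A, ContinuousSMul ℂ A, CompleteSpace A, T2Space A where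
  le_nhds_zero_iff : ∀ l : Filter A,
    l ≤ nhds 0 ↔ ∀ p : ContCStarSeminorm A, Filter.Tendsto p l (nhds 0)

/-- Positive elements of a pro-C*-algebra: those of the form `b* b`. -/
def IsPositiveElement {A : Type*} [NonUnitalRing A] [StarRing A] (a : A) : Prop :=
  ∃ b : A, a = star b * b

variable (E : Type*) [AddCommGroup E] [Module ℂ E]

/-- A right pre-Hilbert module; `rsmul x a` is `x a` and `rinner x y` is the inner product
`⟨x, y⟩_A`, linear in the second variable. -/
class RightPreHilbertModule where
  rsmul : E → A → E
  rinner : E → E → A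
  add_rsmul : ∀ (x y : E) (a : A), rsmul (x + y) a = rsmul x a + rsmul y a
  rsmul_add : ∀ (x : E) (a b : A), rsmul x (a + b) = rsmul x a + rsmul x b
  rsmul_mul : ∀ (x : E) (a b : A), rsmul x (a * b) = rsmul (rsmul x a) b
  smul_rsmul : ∀ (c : ℂ) (x : E) (a : A), rsmul (c • x) a = c • rsmul x a
  rsmul_smul : ∀ (c : ℂ) (x : E) (a : A), rsmul x (c • a) = c • rsmul x a
  rinner_add : ∀ x y z : E, rinner x (y + z) = rinner x y + rinner x z
  rinner_smul : ∀ (c : ℂ) (x y : E), rinner x (c • y) = c • rinner x y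
  rinner_rsmul : ∀ (x y : E) (a : A), rinner x (rsmul y a) = rinner x y * a
  star_rinner : ∀ x y : E, star (rinner y x) = rinner x y
  rinner_self_pos : ∀ x : E, IsPositiveElement (rinner x x)
  rinner_self_eq_zero : ∀ x : E, rinner x x = 0 ↔ x = 0

/-- A left pre-Hilbert module; `lsmul a x` is `a x` and `linner x y` is the inner product
`_A⟨x, y⟩`, linear in the first variable. -/
class LeftPreHilbertModule where
  lsmul : A → E → E
  linner : E → E → A
  lsmul_add : ∀ (a : A) (x y : E), lsmul a (x + y) = lsmul a x + lsmul a y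
  add_lsmul : ∀ (a b : A) (x : E), lsmul (a + b) x = lsmul a x + lsmul b x
  mul_lsmul : ∀ (a b : A) (x : E), lsmul (a * b) x = lsmul a (lsmul b x)
  lsmul_smul : ∀ (c : ℂ) (a : A) (x : E), lsmul a (c • x) = c • lsmul a x
  smul_lsmul : ∀ (c : ℂ) (a : A) (x : E), lsmul (c • a) x = c • lsmul a x
  add_linner : ∀ x y z : E, linner (x + y) z = linner x z + linner y z
  smul_linner : ∀ (c : ℂ) (x y : E), linner (c • x) y = c • linner x y
  lsmul_linner : ∀ (a : A) (x y : E), linner (lsmul a x) y = a * linner x y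
  star_linner : ∀ x y : E, star (linner y x) = linner x y
  linner_self_pos : ∀ x : E, IsPositiveElement (linner x x)
  linner_self_eq_zero : ∀ x : E, linner x x = 0 ↔ x = 0

variable {A E} in
/-- The seminorm `x ↦ √p(⟨x, x⟩_A)` on a right module. -/
noncomputable def rnorm [TopologicalSpace A] [RightPreHilbertModule A E]
    (p : ContCStarSeminorm A) (x : E) : ℝ :=
  Real.sqrt (p (RightPreHilbertModule.rinner x x))

variable {A E} in
/-- The seminorm `x ↦ √p(_A⟨x, x⟩)` on a left module. -/
noncomputable def lnorm [TopologicalSpace A] [LeftPreHilbertModule A E]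
    (p : ContCStarSeminorm A) (x : E) : ℝ :=
  Real.sqrt (p (LeftPreHilbertModule.linner x x))

variable {E} in
/-- Completeness with respect to a family of seminorms: every Cauchy filter converges. -/
def CompleteForSeminorms {ι : Type*} (q : ι → E → ℝ) : Prop :=
  ∀ F : Filter E, F.NeBot →
    (∀ i, ∀ ε : ℝ, 0 < ε → ∃ s ∈ F, ∀ x ∈ s, ∀ y ∈ s, q i (x - y) < ε) →
    ∃ x : E, ∀ i, Filter.Tendsto (fun y => q i (y - x)) F (nhds 0)

/-- A right Hilbert module: a right pre-Hilbert module that is complete for the seminorms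
`rnorm p`. -/
class RightHilbertModule [TopologicalSpace A] extends RightPreHilbertModule A E where
  complete_rnorm : CompleteForSeminorms (fun p : ContCStarSeminorm A => (rnorm p : E → ℝ))

/-- A left Hilbert module. -/
class LeftHilbertModule [TopologicalSpace A] extends LeftPreHilbertModule A E where
  complete_lnorm : CompleteForSeminorms (fun p : ContCStarSeminorm A => (lnorm p : E → ℝ))

/-- A Hilbert pro-C*-bimodule over `A`: a left and right Hilbert `A`-module such that
`_A⟨x, y⟩ z = x ⟨y, z⟩_A` and both module actions are contractive for each seminorm. -/
class HilbertBimodule [TopologicalSpace A] extends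
    RightHilbertModule A E, LeftHilbertModule A E where
  linner_lsmul : ∀ x y z : E, lsmul (linner x y) z = rsmul x (rinner y z)
  rnorm_lsmul_le : ∀ (p : ContCStarSeminorm A) (a : A) (x : E),
    rnorm p (lsmul a x) ≤ p a * rnorm p x
  lnorm_rsmul_le : ∀ (p : ContCStarSeminorm A) (a : A) (x : E),
    lnorm p (rsmul x a) ≤ lnorm p x * p a

end Definitions

section Completions

open UniformSpace

variable {B : Type*} [NormedRing B] [StarRing B] [CStarRing B] [NormedAlgebra ℂ B] [StarModule ℂ B]

/-- The involution on the completion of a normed *-algebra. -/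
noncomputable def complStar (x : Completion B) : Completion B := Completion.map (star : B → B) x

theorem uniformContinuous_cstar : UniformContinuous (star : B → B) :=
  (starNormedAddGroupHom (E := B)).uniformContinuous

theorem complStar_coe (b : B) : complStar (b : Completion B) = ((star b : B) : Completion B) :=
  Completion.map_coe uniformContinuous_cstar b

theorem complStar_cont : Continuous (complStar : Completion B → Completion B) :=
  Completion.continuous_map

/-- The completion of a normed algebra satisfying the C*-identity is a C*-algebra. -/
noncomputable abbrev complCStarAlgebra : CStarAlgebra (Completion B) where
  star := complStar
  star_involutive := fun x => by
    refine Completion.induction_on x (isClosed_eq (complStar_cont.comp complStar_cont) continuous_id)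
      (fun a => ?_)
    rw [complStar_coe, complStar_coe, star_star]
  star_mul := fun x y => by
    refine Completion.induction_on₂ x y (isClosed_eq (complStar_cont.comp continuous_mul)
        ((complStar_cont.comp continuous_snd).mul (complStar_cont.comp continuous_fst)))
      (fun a b => ?_)
    rw [← Completion.coe_mul, complStar_coe, complStar_coe, complStar_coe, star_mul,
      Completion.coe_mul]
  star_add := fun x y => by
    refine Completion.induction_on₂ x y (isClosed_eq (complStar_cont.comp continuous_add)
        ((complStar_cont.comp continuous_fst).add (complStar_cont.comp continuous_snd)))
      (fun a b => ?_)
    rw [← Completion.coe_add, complStar_coe, complStar_coe, complStar_coe, star_add,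
      Completion.coe_add]
  norm_mul_self_le := fun x => by
    change _ ≤ ‖complStar x * x‖
    refine Completion.induction_on x (isClosed_le
        (continuous_norm.mul continuous_norm)
        ((complStar_cont.mul continuous_id).norm)) (fun a => ?_)
    rw [complStar_coe, ← Completion.coe_mul, Completion.norm_coe, Completion.norm_coe,
      CStarRing.norm_star_mul_self]
  norm_smul_le := norm_smul_le
  star_smul := fun r x => by
    refine Completion.induction_on x (isClosed_eq
        (complStar_cont.comp (continuous_const_smul r))
        ((continuous_const_smul (star r)).comp complStar_cont)) (fun a => ?_)
    rw [← Completion.coe_smul, complStar_coe, complStar_coe, star_smul, Completion.coe_smul]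

theorem norm_star_mul_self_le_unital (b c : B) : ‖star b * b‖ ≤ ‖star b * b + star c * c‖ := by
  let : CStarAlgebra (Completion B) := complCStarAlgebra
  let _ := CStarAlgebra.spectralOrder (Completion B)
  have := CStarAlgebra.spectralOrderedRing (Completion B)
  have h := CStarAlgebra.norm_le_norm_of_nonneg_of_le (star_mul_self_nonneg (b : Completion B))
    (le_add_of_nonneg_right (star_mul_self_nonneg (c : Completion B)))
  have e : ∀ d : B, star (d : Completion B) = ((star d : B) : Completion B) := complStar_coe
  rw [e, e, ← Completion.coe_mul, ← Completion.coe_mul, ← Completion.coe_add,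
    Completion.norm_coe, Completion.norm_coe] at h
  exact h

end Completions

section NonUnital

variable {B : Type*} [NonUnitalNormedRing B] [StarRing B] [CStarRing B] [NormedSpace ℂ B]
  [IsScalarTower ℂ B B] [SMulCommClass ℂ B B] [StarModule ℂ B]

theorem norm_star_mul_self_le_nonunital (b c : B) : ‖star b * b‖ ≤ ‖star b * b + star c * c‖ := by
  have := norm_star_mul_self_le_unital (b : Unitization ℂ B) (c : Unitization ℂ B)
  rw [← Unitization.inr_star, ← Unitization.inr_star, ← Unitization.inr_mul,
    ← Unitization.inr_mul, ← Unitization.inr_add,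
    Unitization.norm_inr, Unitization.norm_inr] at this
  exact this

end NonUnital

section CStarSeminorms

variable {A : Type*} [NonUnitalRing A] [StarRing A] [Module ℂ A]
  [IsScalarTower ℂ A A] [SMulCommClass ℂ A A] [StarModule ℂ A]

theorem cstar_seminorm_star (p : Seminorm ℂ A) (hm : ∀ a b, p (a * b) ≤ p a * p b)
    (hs : ∀ a, p (star a * a) = p a ^ 2) (a : A) : p (star a) = p a := by
  have : ∀ a, p a ≤ p (star a) := fun a => by
    rcases (apply_nonneg p a).eq_or_lt with h | h
    · rw [← h]; exact apply_nonneg _ _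
    · have := hm (star a) a
      rw [hs, sq] at this
      exact le_of_mul_le_mul_right this h
  exact le_antisymm (by simpa using this (star a)) (this a)

/-- Monotonicity of C*-seminorms on positive elements. -/
theorem cstar_seminorm_mono (p : Seminorm ℂ A) (hm : ∀ a b, p (a * b) ≤ p a * p b)
    (hs : ∀ a, p (star a * a) = p a ^ 2) (b c : A) :
    p (star b * b) ≤ p (star b * b + star c * c) := by
  let i1 : NonUnitalSeminormedRing A :=
    { ‹NonUnitalRing A›, p.toSeminormedAddCommGroup with norm_mul_le := hm }
  let i2 : NormedSpace ℂ A := { norm_smul_le := fun r a => (map_smul_eq_mul p r a).le }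
  have hst := cstar_seminorm_star p hm hs
  let Q := SeparationQuotient A
  let st : Q → Q := SeparationQuotient.lift (fun a => SeparationQuotient.mk (star a)) (by
    intro x y h
    rw [SeparationQuotient.mk_eq_mk]
    rw [Metric.inseparable_iff, dist_eq_norm] at h ⊢
    rw [← star_sub]
    exact (hst _).trans h)
  have hst' : ∀ a : A, st (SeparationQuotient.mk a) = SeparationQuotient.mk (star a) := fun a => rfl
  let i3 : StarRing Q :=
    { star := st
      star_involutive := fun x => by
        obtain ⟨x, rfl⟩ := SeparationQuotient.surjective_mk x
        rw [hst', hst', star_star]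
      star_mul := fun x y => by
        obtain ⟨x, rfl⟩ := SeparationQuotient.surjective_mk x
        obtain ⟨y, rfl⟩ := SeparationQuotient.surjective_mk y
        change st _ = st _ * st _
        rw [← SeparationQuotient.mk_mul, hst', hst', hst', star_mul, SeparationQuotient.mk_mul]
      star_add := fun x y => by
        obtain ⟨x, rfl⟩ := SeparationQuotient.surjective_mk x
        obtain ⟨y, rfl⟩ := SeparationQuotient.surjective_mk y
        change st _ = st _ + st _
        rw [← SeparationQuotient.mk_add, hst', hst', hst', star_add, SeparationQuotient.mk_add] }
  have : CStarRing Q := ⟨fun x => by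
    obtain ⟨x, rfl⟩ := SeparationQuotient.surjective_mk x
    change _ ≤ ‖SeparationQuotient.mk (star x) * SeparationQuotient.mk x‖
    rw [← SeparationQuotient.mk_mul, SeparationQuotient.norm_mk, SeparationQuotient.norm_mk, ← sq]
    exact (hs x).ge⟩
  have : StarModule ℂ Q := ⟨fun r x => by
    obtain ⟨x, rfl⟩ := SeparationQuotient.surjective_mk x
    change st _ = star r • st _
    rw [← SeparationQuotient.mk_smul, hst', hst', star_smul, SeparationQuotient.mk_smul]⟩
  have : IsScalarTower ℂ Q Q := ⟨fun r x y => by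
    obtain ⟨x, rfl⟩ := SeparationQuotient.surjective_mk x
    obtain ⟨y, rfl⟩ := SeparationQuotient.surjective_mk y
    exact congrArg SeparationQuotient.mk (smul_mul_assoc r x y)⟩
  have : SMulCommClass ℂ Q Q := ⟨fun r x y => by
    obtain ⟨x, rfl⟩ := SeparationQuotient.surjective_mk x
    obtain ⟨y, rfl⟩ := SeparationQuotient.surjective_mk y
    exact congrArg SeparationQuotient.mk (mul_smul_comm r x y).symm⟩
  have := norm_star_mul_self_le_nonunital (SeparationQuotient.mk b : Q) (SeparationQuotient.mk c : Q)
  have e : ∀ d : A, star (SeparationQuotient.mk d : Q) = SeparationQuotient.mk (star d) := hst'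
  rw [e, e, ← SeparationQuotient.mk_mul, ← SeparationQuotient.mk_mul, ← SeparationQuotient.mk_add,
    SeparationQuotient.norm_mk, SeparationQuotient.norm_mk] at this
  exact this

end CStarSeminorms

section Operators

variable {A : Type*} [NonUnitalRing A] [StarRing A] [Module ℂ A]
  [IsScalarTower ℂ A A] [SMulCommClass ℂ A A] [StarModule ℂ A] [TopologicalSpace A]

theorem ContCStarSeminorm.mul_le (p : ContCStarSeminorm A) (a b : A) : p (a * b) ≤ p a * p b :=
  p.mul_le' a b

theorem ContCStarSeminorm.star_mul_self (p : ContCStarSeminorm A) (a : A) :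
    p (star a * a) = p a ^ 2 :=
  p.star_mul_self' a

theorem ContCStarSeminorm.map_star (p : ContCStarSeminorm A) (a : A) : p (star a) = p a :=
  cstar_seminorm_star p.toSeminorm p.mul_le p.star_mul_self a

theorem ContCStarSeminorm.map_real_smul (p : ContCStarSeminorm A) {r : ℝ} (hr : 0 ≤ r) (a : A) :
    p ((r : ℂ) • a) = r * p a := by
  have h := map_smul_eq_mul p.toSeminorm (r : ℂ) a
  rwa [Complex.norm_real, Real.norm_of_nonneg hr] at h

theorem ContCStarSeminorm.mono (p : ContCStarSeminorm A) {r : ℝ} (hr : 0 ≤ r) {u v : A}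
    (hu : IsPositiveElement u) (hv : IsPositiveElement v) :
    r * p u ≤ p ((r : ℂ) • u + v) := by
  obtain ⟨b, rfl⟩ := hu
  obtain ⟨c, rfl⟩ := hv
  have h := cstar_seminorm_mono p.toSeminorm p.mul_le p.star_mul_self
    (((Real.sqrt r : ℝ) : ℂ) • b) c
  have e : star (((Real.sqrt r : ℝ) : ℂ) • b) * (((Real.sqrt r : ℝ) : ℂ) • b)
      = (r : ℂ) • (star b * b) := by
    rw [star_smul, smul_mul_smul_comm]
    congr 1
    rw [Complex.star_def, Complex.conj_ofReal, ← Complex.ofReal_mul, Real.mul_self_sqrt hr]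
  rw [e] at h
  rw [← p.map_real_smul hr]
  exact h

variable {E : Type*} [AddCommGroup E] [Module ℂ E] [RightPreHilbertModule A E]

open RightPreHilbertModule

theorem add_rinner (x y z : E) : (rinner (x + y) z : A) = rinner x z + rinner y z := by
  rw [← star_rinner, rinner_add, star_add, star_rinner, star_rinner]

theorem smul_rinner (c : ℂ) (x y : E) : (rinner (c • x) y : A) = star c • rinner x y := by
  rw [← star_rinner, rinner_smul, star_smul, star_rinner]

theorem rsmul_rinner (x y : E) (a : A) : (rinner (rsmul x a) y : A) = star a * rinner x y := by
  rw [← star_rinner, rinner_rsmul, star_mul, star_rinner]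

theorem rnorm_nonneg (p : ContCStarSeminorm A) (x : E) : 0 ≤ rnorm p x := Real.sqrt_nonneg _

theorem rnorm_sq (p : ContCStarSeminorm A) (x : E) : rnorm p x ^ 2 = p (rinner x x) :=
  Real.sq_sqrt (apply_nonneg p.toSeminorm _)

theorem rnorm_smul (p : ContCStarSeminorm A) (c : ℂ) (x : E) :
    rnorm p (c • x) = ‖c‖ * rnorm p x := by
  refine (pow_left_inj₀ (rnorm_nonneg _ _)
    (mul_nonneg (norm_nonneg _) (rnorm_nonneg _ _)) two_ne_zero).1 ?_
  rw [mul_pow, rnorm_sq, rnorm_sq, rinner_smul, smul_rinner, smul_smul]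
  refine (map_smul_eq_mul p.toSeminorm _ _).trans ?_
  rw [norm_mul, norm_star, sq]

theorem rnorm_zero (p : ContCStarSeminorm A) : rnorm p (0 : E) = 0 := by
  have h := rnorm_smul p 0 (0 : E)
  rwa [smul_zero, norm_zero, zero_mul] at h

theorem rnorm_add_le (p : ContCStarSeminorm A) (x y : E) :
    rnorm p (x + y) ≤ rnorm p x + rnorm p y := by
  refine le_of_forall_pos_le_add fun ε hε => ?_
  set a := rnorm p x with ha
  set b := rnorm p y with hb
  have ha0 : 0 ≤ a := rnorm_nonneg _ _
  have hb0 : 0 ≤ b := rnorm_nonneg _ _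
  obtain ⟨s, hs⟩ : ∃ s, s = a + ε / 2 := ⟨_, rfl⟩
  obtain ⟨t, ht⟩ : ∃ t, t = b + ε / 2 := ⟨_, rfl⟩
  have hs0 : 0 < s := by linarith
  have ht0 : 0 < t := by linarith
  have h := p.mono (mul_nonneg hs0.le ht0.le) (rinner_self_pos (A := A) (x + y))
    (rinner_self_pos (A := A) ((t : ℂ) • x + ((-s : ℝ) : ℂ) • y))
  have e : (((s * t : ℝ) : ℂ) • rinner (x + y) (x + y)
      + rinner ((t : ℂ) • x + ((-s : ℝ) : ℂ) • y) ((t : ℂ) • x + ((-s : ℝ) : ℂ) • y) : A)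
      = ((t * (s + t) : ℝ) : ℂ) • rinner x x + ((s * (s + t) : ℝ) : ℂ) • rinner y y := by
    simp only [add_rinner, rinner_add, smul_rinner, rinner_smul, Complex.star_def,
      Complex.conj_ofReal]
    push_cast
    module
  rw [e, ← rnorm_sq] at h
  have h1 := h.trans (map_add_le_add p.toSeminorm _ _)
  have hst : 0 ≤ s + t := by linarith
  have h2 := p.map_real_smul (mul_nonneg ht0.le hst) (rinner x x)
  have h3 := p.map_real_smul (mul_nonneg hs0.le hst) (rinner y y)
  rw [← rnorm_sq] at h2 h3
  rw [h2, h3, ← ha, ← hb] at h1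
  have h4 : a ^ 2 ≤ s ^ 2 := by apply pow_le_pow_left₀ ha0; linarith
  have h5 : b ^ 2 ≤ t ^ 2 := by apply pow_le_pow_left₀ hb0; linarith
  have h6 : s * t * rnorm p (x + y) ^ 2 ≤ s * t * (s + t) ^ 2 :=
    calc _ ≤ _ := h1
      _ ≤ t * (s + t) * s ^ 2 + s * (s + t) * t ^ 2 := by gcongr
      _ = _ := by ring
  have h7 := (pow_le_pow_iff_left₀ (rnorm_nonneg p _) hst two_ne_zero).1
    (le_of_mul_le_mul_left h6 (mul_pos hs0 ht0))
  linarith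

theorem norm_rinner_le (p : ContCStarSeminorm A) (y z : E) :
    p (rinner y z) ≤ rnorm p y * rnorm p z := by
  refine (pow_le_pow_iff_left₀ (apply_nonneg p.toSeminorm _)
    (mul_nonneg (rnorm_nonneg _ _) (rnorm_nonneg _ _)) two_ne_zero).1 ?_
  rw [mul_pow, rnorm_sq, rnorm_sq]
  have key : ∀ s : ℝ, p (rinner z z) < s → p (rinner y z) ^ 2 ≤ p (rinner y y) * s := by
    intro s hs
    have hs0 : 0 < s := (apply_nonneg p.toSeminorm _).trans_lt hs
    have h := p.mono (u := star (rinner z y) * (rinner z y)) (r := 2 * s) (by linarith) ⟨_, rfl⟩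
      (rinner_self_pos (A := A) ((s : ℂ) • y + ((-1 : ℝ) : ℂ) • rsmul z (rinner z y : A)))
    have e : (((2 * s : ℝ) : ℂ) • (star (rinner z y) * (rinner z y))
        + rinner ((s : ℂ) • y + ((-1 : ℝ) : ℂ) • rsmul z (rinner z y : A))
          ((s : ℂ) • y + ((-1 : ℝ) : ℂ) • rsmul z (rinner z y : A)) : A)
        = ((s ^ 2 : ℝ) : ℂ) • rinner y y
          + star (rinner z y) * rinner z z * rinner z y := by
      simp only [add_rinner, rinner_add, smul_rinner, rinner_smul, rsmul_rinner, rinner_rsmul,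
        Complex.star_def, Complex.conj_ofReal, star_rinner, add_mul, smul_mul_assoc]
      push_cast
      module
    rw [e, p.star_mul_self] at h
    have h1 := h.trans (map_add_le_add p.toSeminorm _ _)
    have h2 := p.map_real_smul (sq_nonneg s) (rinner y y)
    have h3 : p (star (rinner z y) * rinner z z * rinner z y)
        ≤ p (rinner z y) * p (rinner z z) * p (rinner z y) := by
      refine (p.mul_le _ _).trans ?_
      refine mul_le_mul_of_nonneg_right ?_ (apply_nonneg p.toSeminorm _)
      refine (p.mul_le _ _).trans ?_
      rw [p.map_star]
    have h4 : p (rinner y z) = p (rinner z y) := by rw [← star_rinner, p.map_star]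
    rw [h4]
    rw [h2] at h1
    have h5 : p (rinner z y) * p (rinner z z) * p (rinner z y) ≤ s * p (rinner z y) ^ 2 := by
      have := mul_le_mul_of_nonneg_right hs.le (sq_nonneg (p (rinner z y)))
      nlinarith
    have h6 : s * p (rinner z y) ^ 2 ≤ s * (p (rinner y y) * s) := by
      have h7 := h1.trans (add_le_add_right (h3.trans h5) _)
      nlinarith
    exact le_of_mul_le_mul_left h6 hs0
  have hc : Filter.Tendsto (fun s : ℝ => p (rinner y y) * s)
      (nhdsWithin (p (rinner z z)) (Set.Ioi (p (rinner z z))))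
      (nhds (p (rinner y y) * p (rinner z z))) :=
    ((continuous_const.mul continuous_id).tendsto _).mono_left nhdsWithin_le_nhds
  exact ge_of_tendsto hc (Filter.eventually_of_mem self_mem_nhdsWithin key)

theorem rnorm_rsmul_le (p : ContCStarSeminorm A) (x : E) (a : A) :
    rnorm p (rsmul x a) ≤ rnorm p x * p a := by
  have ha := apply_nonneg p.toSeminorm a
  refine (pow_le_pow_iff_left₀ (rnorm_nonneg _ _) (mul_nonneg (rnorm_nonneg _ _) ha)
    two_ne_zero).1 ?_
  rw [mul_pow, rnorm_sq, rnorm_sq, rinner_rsmul, rsmul_rinner]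
  calc p (star a * rinner x x * a) ≤ p (star a * rinner x x) * p a := p.mul_le _ _
    _ ≤ (p (star a) * p (rinner x x)) * p a := mul_le_mul_of_nonneg_right (p.mul_le _ _) ha
    _ = _ := by rw [p.map_star]; ring

/-- `T` is adjointable if `⟨T x, y⟩ = ⟨x, S y⟩` for some map `S`. -/
def IsAdjointable (A : Type*) [NonUnitalRing A] [StarRing A] [Module ℂ A] {E : Type*}
    [AddCommGroup E] [Module ℂ E] [RightPreHilbertModule A E] (T : E → E) : Prop :=
  ∃ S : E → E, ∀ x y : E, (rinner (T x) y : A) = rinner x (S y)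

variable (A E) in
/-- The algebra `L_A(E)` of bounded adjointable `A`-module maps on `E`. -/
def AdjointableOperators : Subalgebra ℂ (Module.End ℂ E) where
  carrier := {T | (∀ (x : E) (a : A), T (rsmul x a) = rsmul (T x) a) ∧ IsAdjointable A T ∧
    ∀ p : ContCStarSeminorm A, ∃ k : ℝ, 0 < k ∧ ∀ x : E, rnorm p (T x) ≤ k * rnorm p x}
  mul_mem' := by
    rintro T T' ⟨h1, ⟨S, hS⟩, h3⟩ ⟨h1', ⟨S', hS'⟩, h3'⟩
    refine ⟨fun x a => ?_, ⟨fun y => S' (S y), fun x y => ?_⟩, fun p => ?_⟩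
    · simp only [Module.End.mul_apply, h1', h1]
    · simp only [Module.End.mul_apply, hS, hS']
    · obtain ⟨k, hk, hT⟩ := h3 p
      obtain ⟨k', hk', hT'⟩ := h3' p
      refine ⟨k * k', mul_pos hk hk', fun x => (hT _).trans ?_⟩
      rw [mul_assoc]
      exact mul_le_mul_of_nonneg_left (hT' x) hk.le
  add_mem' := by
    rintro T T' ⟨h1, ⟨S, hS⟩, h3⟩ ⟨h1', ⟨S', hS'⟩, h3'⟩
    refine ⟨fun x a => ?_, ⟨fun y => S y + S' y, fun x y => ?_⟩, fun p => ?_⟩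
    · simp only [LinearMap.add_apply, h1', h1, add_rsmul]
    · simp only [LinearMap.add_apply, add_rinner, rinner_add, hS, hS']
    · obtain ⟨k, hk, hT⟩ := h3 p
      obtain ⟨k', hk', hT'⟩ := h3' p
      refine ⟨k + k', add_pos hk hk', fun x => (rnorm_add_le p _ _).trans ?_⟩
      rw [add_mul]
      exact add_le_add (hT x) (hT' x)
  algebraMap_mem' := by
    intro c
    refine ⟨fun x a => ?_, ⟨fun y => star c • y, fun x y => ?_⟩, fun p => ?_⟩
    · simp only [Module.algebraMap_end_apply, smul_rsmul]
    · simp only [Module.algebraMap_end_apply, smul_rinner, rinner_smul]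
    · refine ⟨‖c‖ + 1, by positivity, fun x => ?_⟩
      rw [Module.algebraMap_end_apply, rnorm_smul, add_mul, one_mul]
      exact le_add_of_nonneg_right (rnorm_nonneg p x)

theorem bddAbove_opNorm (p : ContCStarSeminorm A) (T : AdjointableOperators A E) :
    BddAbove {r : ℝ | ∃ x : E, rnorm p x ≤ 1 ∧ r = rnorm p (T.1 x)} := by
  obtain ⟨k, hk, h⟩ := T.2.2.2 p
  refine ⟨k, ?_⟩
  rintro _ ⟨x, hx, rfl⟩
  exact (h x).trans (by nlinarith)

/-- The seminorm `T ↦ sup {rnorm p (T x) : rnorm p x ≤ 1}` on `L_A(E)`. -/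
noncomputable def opSeminorm (p : ContCStarSeminorm A) :
    Seminorm ℂ (AdjointableOperators A E) :=
  Seminorm.ofSMulLE
    (fun T => sSup {r : ℝ | ∃ x : E, rnorm p x ≤ 1 ∧ r = rnorm p (T.1 x)})
    (by
      refine le_antisymm (Real.sSup_le ?_ le_rfl) (Real.sSup_nonneg ?_)
      · rintro _ ⟨x, _, rfl⟩
        exact (rnorm_zero p).le
      · rintro _ ⟨x, _, rfl⟩
        exact rnorm_nonneg p _)
    (by
      intro T S
      refine csSup_le ⟨_, 0, (rnorm_zero p).le.trans zero_le_one, rfl⟩ ?_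
      rintro _ ⟨x, hx, rfl⟩
      exact (rnorm_add_le p _ _).trans (add_le_add
        (le_csSup (bddAbove_opNorm p T) ⟨x, hx, rfl⟩)
        (le_csSup (bddAbove_opNorm p S) ⟨x, hx, rfl⟩)))
    (by
      intro c T
      refine csSup_le ⟨_, 0, (rnorm_zero p).le.trans zero_le_one, rfl⟩ ?_
      rintro _ ⟨x, hx, rfl⟩
      refine (rnorm_smul p c (T.1 x)).le.trans (mul_le_mul_of_nonneg_left ?_ (norm_nonneg c))
      exact le_csSup (bddAbove_opNorm p T) ⟨x, hx, rfl⟩)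

theorem opSeminorm_apply (p : ContCStarSeminorm A) (T : AdjointableOperators A E) :
    opSeminorm p T = sSup {r : ℝ | ∃ x : E, rnorm p x ≤ 1 ∧ r = rnorm p (T.1 x)} :=
  rfl

theorem rnorm_apply_le (p : ContCStarSeminorm A) (T : AdjointableOperators A E) (x : E) :
    rnorm p (T.1 x) ≤ opSeminorm p T * rnorm p x := by
  rcases (rnorm_nonneg p x).eq_or_lt with h | h
  · obtain ⟨k, _, hk⟩ := T.2.2.2 p
    have := hk x
    rw [← h, mul_zero] at this ⊢
    exact this
  · have h1 : rnorm p (((rnorm p x)⁻¹ : ℝ) • x) = 1 := by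
      rw [← Complex.coe_smul, rnorm_smul, Complex.norm_real, norm_inv, Real.norm_of_nonneg h.le,
        inv_mul_cancel₀ h.ne']
    have h2 := le_csSup (bddAbove_opNorm p T) ⟨_, h1.le, rfl⟩
    rw [← opSeminorm_apply, ← Complex.coe_smul, map_smul, rnorm_smul, Complex.norm_real, norm_inv,
      Real.norm_of_nonneg h.le, inv_mul_le_iff₀ h] at h2
    rwa [mul_comm]

theorem opSeminorm_mul_le (p : ContCStarSeminorm A) (S T : AdjointableOperators A E) :
    opSeminorm p (S * T) ≤ opSeminorm p S * opSeminorm p T := by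
  rw [opSeminorm_apply p (S * T)]
  refine csSup_le ⟨_, 0, (rnorm_zero p).le.trans zero_le_one, rfl⟩ ?_
  rintro _ ⟨x, hx, rfl⟩
  refine (rnorm_apply_le p S (T.1 x)).trans
    (mul_le_mul_of_nonneg_left ?_ (apply_nonneg (opSeminorm p) S))
  exact le_csSup (bddAbove_opNorm p T) ⟨x, hx, rfl⟩

variable (A E) in
/-- The topology of `L_A(E)`, defined by the seminorms `opSeminorm p`. -/
@[reducible]
noncomputable def operatorTopology : TopologicalSpace (AdjointableOperators A E) :=
  SeminormFamily.moduleFilterBasis (𝕜 := ℂ) (F := AdjointableOperators A E)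
    (fun p : ContCStarSeminorm A => opSeminorm p) |>.topology

/-- The operator `θ_{x,y} : ξ ↦ x ⟨y, ξ⟩_A`. -/
def theta (x y : E) : AdjointableOperators A E where
  val :=
    { toFun := fun ξ => rsmul x (rinner y ξ : A)
      map_add' := fun ξ η => by rw [rinner_add, rsmul_add]
      map_smul' := fun c ξ => by rw [rinner_smul, rsmul_smul, RingHom.id_apply] }
  property := by
    refine ⟨fun ξ a => ?_, ⟨fun η => rsmul y (rinner x η : A), fun ξ η => ?_⟩, fun p => ?_⟩
    · change rsmul x (rinner y (rsmul ξ a) : A) = rsmul (rsmul x (rinner y ξ : A)) a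
      rw [rinner_rsmul, rsmul_mul]
    · change (rinner (rsmul x (rinner y ξ : A)) η : A) = _
      rw [rsmul_rinner, rinner_rsmul, star_rinner]
    · refine ⟨rnorm p x * rnorm p y + 1,
        add_pos_of_nonneg_of_pos (mul_nonneg (rnorm_nonneg _ _) (rnorm_nonneg _ _)) one_pos,
        fun ξ => ?_⟩
      have h1 := rnorm_rsmul_le p x (rinner y ξ : A)
      have h2 := mul_le_mul_of_nonneg_left (norm_rinner_le p y ξ) (rnorm_nonneg p x)
      have h3 := rnorm_nonneg p ξ
      change rnorm p (rsmul x (rinner y ξ : A)) ≤ _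
      linarith

variable (A E) in
/-- The linear span of the operators `θ_{x,y}`. -/
def finiteRankOperators : Submodule ℂ (AdjointableOperators A E) :=
  Submodule.span ℂ {T | ∃ x y : E, T = theta x y}

theorem theta_mul_theta (x y u v : E) :
    (theta x y * theta u v : AdjointableOperators A E) = theta (rsmul x (rinner y u : A)) v := by
  ext ξ
  change rsmul x (rinner y (rsmul u (rinner v ξ : A)) : A)
    = rsmul (rsmul x (rinner y u : A)) (rinner v ξ : A)
  rw [rinner_rsmul, rsmul_mul]

theorem finiteRankOperators_mul_mem {S T : AdjointableOperators A E}
    (hS : S ∈ finiteRankOperators A E) (hT : T ∈ finiteRankOperators A E) :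
    S * T ∈ finiteRankOperators A E := by
  have h := Submodule.mul_mem_mul hS hT
  rw [finiteRankOperators, Submodule.span_mul_span] at h
  refine Submodule.span_mono ?_ h
  rintro _ ⟨_, ⟨x, y, rfl⟩, _, ⟨u, v, rfl⟩, rfl⟩
  exact ⟨_, _, theta_mul_theta x y u v⟩

theorem continuous_mul_left_operator (S : AdjointableOperators A E) :
    @Continuous _ _ (operatorTopology A E) (operatorTopology A E) (fun T => S * T) := by
  let _ := operatorTopology A E
  have hw : WithSeminorms (𝕜 := ℂ) (E := AdjointableOperators A E)
    (fun p : ContCStarSeminorm A => opSeminorm p) := ⟨rfl⟩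
  refine WithSeminorms.continuous_of_isBounded hw hw (LinearMap.mulLeft ℂ S) fun p => ?_
  refine ⟨{p}, ⟨opSeminorm p S, apply_nonneg _ _⟩, fun T => ?_⟩
  rw [Finset.sup_singleton]
  exact opSeminorm_mul_le p S T

theorem continuous_mul_right_operator (S : AdjointableOperators A E) :
    @Continuous _ _ (operatorTopology A E) (operatorTopology A E) (fun T => T * S) := by
  let _ := operatorTopology A E
  have hw : WithSeminorms (𝕜 := ℂ) (E := AdjointableOperators A E)
    (fun p : ContCStarSeminorm A => opSeminorm p) := ⟨rfl⟩
  refine WithSeminorms.continuous_of_isBounded hw hw (LinearMap.mulRight ℂ S) fun p => ?_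
  refine ⟨{p}, ⟨opSeminorm p S, apply_nonneg _ _⟩, fun T => ?_⟩
  have := opSeminorm_mul_le p T S
  rw [mul_comm (opSeminorm p T)] at this
  rw [Finset.sup_singleton]
  exact this

variable (A E) in
/-- The algebra `K_A(E)` of compact operators: the closure in `L_A(E)` of the linear span of the
operators `θ_{x,y}`. -/
def CompactOperators : NonUnitalSubalgebra ℂ (AdjointableOperators A E) where
  carrier := @closure _ (operatorTopology A E) (finiteRankOperators A E)
  add_mem' := by
    let _ := operatorTopology A E
    have hw : WithSeminorms (𝕜 := ℂ) (E := AdjointableOperators A E)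
      (fun p : ContCStarSeminorm A => opSeminorm p) := ⟨rfl⟩
    have := hw.topologicalAddGroup
    have := hw.continuousSMul
    exact fun {S T} hS hT => (finiteRankOperators A E).topologicalClosure.add_mem hS hT
  zero_mem' := @subset_closure _ (operatorTopology A E) _ _ (finiteRankOperators A E).zero_mem
  smul_mem' := by
    let _ := operatorTopology A E
    have hw : WithSeminorms (𝕜 := ℂ) (E := AdjointableOperators A E)
      (fun p : ContCStarSeminorm A => opSeminorm p) := ⟨rfl⟩
    have := hw.topologicalAddGroup
    have := hw.continuousSMul
    exact fun c T hT => (finiteRankOperators A E).topologicalClosure.smul_mem c hT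
  mul_mem' := by
    let _ := operatorTopology A E
    intro S T hS hT
    have h1 : ∀ R ∈ finiteRankOperators A E,
        R * T ∈ closure (finiteRankOperators A E : Set (AdjointableOperators A E)) := fun R hR =>
      map_mem_closure (continuous_mul_left_operator R) hT
        fun Q hQ => finiteRankOperators_mul_mem hR hQ
    have h2 := map_mem_closure (continuous_mul_right_operator T) hS h1
    rwa [closure_closure] at h2

end Operators

/-- A derivation on a complex algebra: a linear map `D` from the algebra into itself with
`D (a b) = D(a) b + a D(b)`. -/
def IsDerivation {B : Type*} [NonUnitalNonAssocSemiring B] [Module ℂ B] (D : B →ₗ[ℂ] B) : Prop :=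
  ∀ a b : B, D (a * b) = D a * b + a * D b

end ProCStar

/-!
By Gelfand theory, a continuous C*-seminorm of a commutative algebra is attained at each element by
a continuous character, so an element killed by all continuous characters is zero. Let `d` be a
derivation from a closed *-subalgebra `J` into the algebra. Continuous functional calculus factors
a self-adjoint `b ∈ J` as `g * h` with `g, h ∈ J` killed by every character `χ` that kills `b`,
hence `χ (d b) = 0` whenever `χ b = 0`. If `χ b ≠ 0`, then `b² - χ(b) b` is killed by `χ`, and
`χ (d (b² - χ(b) b)) = χ(b) χ(d b)` gives `χ (d b) = 0` again. So `d = 0`.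

In a Hilbert bimodule, `θ_{x,y}` is the left action of `_A⟨x, y⟩`, so left actions commute with all
adjointable operators, and every matrix coefficient `b ↦ _A⟨D(L_b) u, v⟩` is such a derivation `d`.
Hence `D` kills every `θ_{x,y}`, and `D(T) θ_{x,y} = D(θ_{Tx,y}) - T D(θ_{x,y}) = 0` forces
`D(T) = 0`.
-/

namespace ProCStar

section SeparationQuotient

variable {R B : Type*} [TopologicalSpace B]

instance [Star B] [ContinuousStar B] : Star (SeparationQuotient B) where
  star := SeparationQuotient.lift (fun b => SeparationQuotient.mk (star b)) fun _ _ h =>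
    SeparationQuotient.mk_eq_mk.2 (h.map continuous_star)

instance [NonUnitalNonAssocSemiring B] [IsTopologicalSemiring B] [StarRing B] [ContinuousStar B] :
    StarRing (SeparationQuotient B) where
  star_involutive := SeparationQuotient.surjective_mk.forall.2 fun b =>
    congrArg SeparationQuotient.mk (star_star b)
  star_mul := SeparationQuotient.surjective_mk.forall₂.2 fun b c =>
    congrArg SeparationQuotient.mk (star_mul b c)
  star_add := SeparationQuotient.surjective_mk.forall₂.2 fun b c =>
    congrArg SeparationQuotient.mk (star_add b c)

instance [Star B] [ContinuousStar B] [Star R] [SMul R B] [ContinuousConstSMul R B]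
    [StarModule R B] : StarModule R (SeparationQuotient B) where
  star_smul r := SeparationQuotient.surjective_mk.forall.2 fun b =>
    congrArg SeparationQuotient.mk (star_smul r b)

instance [NonUnitalNonAssocSemiring B] [IsTopologicalSemiring B] [SMul R B]
    [ContinuousConstSMul R B] [IsScalarTower R B B] :
    IsScalarTower R (SeparationQuotient B) (SeparationQuotient B) where
  smul_assoc r := SeparationQuotient.surjective_mk.forall₂.2 fun b c =>
    congrArg SeparationQuotient.mk (smul_mul_assoc r b c)

instance [NonUnitalNonAssocSemiring B] [IsTopologicalSemiring B] [SMul R B]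
    [ContinuousConstSMul R B] [SMulCommClass R B B] :
    SMulCommClass R (SeparationQuotient B) (SeparationQuotient B) where
  smul_comm r := SeparationQuotient.surjective_mk.forall₂.2 fun b c =>
    congrArg SeparationQuotient.mk (mul_smul_comm r b c).symm

end SeparationQuotient

section Characters

open UniformSpace

theorem exists_starAlgHom_norm_eq {B : Type*} [NormedRing B] [StarRing B] [CStarRing B]
    [NormedAlgebra ℂ B] [StarModule ℂ B] [Nontrivial B] (hcomm : ∀ a b : B, a * b = b * a) (a : B) :
    ∃ χ : B →⋆ₐ[ℂ] ℂ, (∀ b, ‖χ b‖ ≤ ‖b‖) ∧ ‖χ a‖ = ‖a‖ := by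
  let : CommCStarAlgebra (Completion B) :=
    { complCStarAlgebra with
      mul_comm := fun x y => Completion.induction_on₂ x y
        (isClosed_eq continuous_mul (continuous_snd.mul continuous_fst)) fun b c => by
          rw [← Completion.coe_mul, hcomm, Completion.coe_mul] }
  have : Nontrivial (Completion B) := (Completion.coe_injective B).nontrivial
  obtain ⟨z, hz, hzr⟩ := spectrum.exists_nnnorm_eq_spectralRadius (a : Completion B)
  have hnormal : IsStarNormal (a : Completion B) := ⟨mul_comm _ _⟩
  obtain ⟨φ, rfl⟩ := WeakDual.CharacterSpace.mem_spectrum_iff_exists.1 hz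
  rw [hnormal.spectralRadius_eq_nnnorm, ENNReal.coe_inj] at hzr
  let χ : B →⋆ₐ[ℂ] ℂ :=
    { (φ : Completion B →+* ℂ).comp Completion.coeRingHom with
      commutes' := fun c => AlgHomClass.commutes φ c
      map_star' := fun b => (congrArg φ (complStar_coe b).symm).trans (map_star φ _) }
  refine ⟨χ, fun b => ?_, ?_⟩
  · exact (spectrum.norm_le_norm_of_mem (AlgHom.apply_mem_spectrum φ _)).trans_eq
      (Completion.norm_coe b)
  · exact (congrArg NNReal.toReal hzr).trans (Completion.norm_coe a)

theorem exists_nonUnitalStarAlgHom_norm_eq {B : Type*} [NonUnitalNormedRing B] [StarRing B]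
    [CStarRing B] [NormedSpace ℂ B] [IsScalarTower ℂ B B] [SMulCommClass ℂ B B] [StarModule ℂ B]
    (hcomm : ∀ a b : B, a * b = b * a) (a : B) :
    ∃ χ : B →⋆ₙₐ[ℂ] ℂ, (∀ b, ‖χ b‖ ≤ ‖b‖) ∧ ‖χ a‖ = ‖a‖ := by
  have hcomm_unitization (x y : Unitization ℂ B) : x * y = y * x := by
    ext
    · exact mul_comm _ _
    · simp only [Unitization.snd_mul, hcomm x.snd y.snd]
      abel
  obtain ⟨χ, hle, heq⟩ := exists_starAlgHom_norm_eq hcomm_unitization (a : Unitization ℂ B)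
  refine ⟨(χ : Unitization ℂ B →⋆ₙₐ[ℂ] ℂ).comp (Unitization.inrNonUnitalStarAlgHom ℂ B),
    fun b => (hle b).trans_eq (Unitization.norm_inr b), heq.trans (Unitization.norm_inr a)⟩

variable {A : Type*} [NonUnitalRing A] [StarRing A] [Module ℂ A]
  [IsScalarTower ℂ A A] [SMulCommClass ℂ A A] [StarModule ℂ A]

theorem exists_nonUnitalStarAlgHom_norm_eq_seminorm (p : Seminorm ℂ A)
    (hmul : ∀ a b, p (a * b) ≤ p a * p b) (hstar : ∀ a, p (star a * a) = p a ^ 2)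
    (hcomm : ∀ a b : A, a * b = b * a) (a : A) :
    ∃ χ : A →⋆ₙₐ[ℂ] ℂ, (∀ b, ‖χ b‖ ≤ p b) ∧ ‖χ a‖ = p a := by
  let : NonUnitalSeminormedRing A :=
    { ‹NonUnitalRing A›, p.toSeminormedAddCommGroup with norm_mul_le := hmul }
  let : NormedSpace ℂ A := { norm_smul_le := fun r a => (map_smul_eq_mul p r a).le }
  have : NormedStarGroup A := ⟨fun a => (cstar_seminorm_star p hmul hstar a).le⟩
  have : CStarRing (SeparationQuotient A) := ⟨SeparationQuotient.surjective_mk.forall.2 fun b =>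
    ((pow_two (p b)).symm.trans (hstar b).symm).le⟩
  have hcomm_quotient : ∀ x y : SeparationQuotient A, x * y = y * x :=
    SeparationQuotient.surjective_mk.forall₂.2 fun b c => congrArg SeparationQuotient.mk (hcomm b c)
  obtain ⟨χ, hle, heq⟩ :=
    exists_nonUnitalStarAlgHom_norm_eq hcomm_quotient (SeparationQuotient.mk a)
  let π : A →⋆ₙₐ[ℂ] SeparationQuotient A :=
    { toFun := SeparationQuotient.mk
      map_smul' := fun _ _ => rfl
      map_zero' := rfl
      map_add' := fun _ _ => rfl
      map_mul' := fun _ _ => rfl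
      map_star' := fun _ => rfl }
  exact ⟨χ.comp π, fun b => (hle _).trans_eq (SeparationQuotient.norm_mk b),
    heq.trans (SeparationQuotient.norm_mk a)⟩

end Characters

section ContinuousCharacters

open Filter Topology

variable {A : Type*} [NonUnitalRing A] [StarRing A] [Module ℂ A]

theorem ofReal_re_apply_of_isSelfAdjoint (χ : A →⋆ₙₐ[ℂ] ℂ) {b : A} (hb : IsSelfAdjoint b) :
    ((χ b).re : ℂ) = χ b :=
  Complex.conj_eq_iff_re.1 (hb.map χ).star_eq

variable [UniformSpace A] [ProCStarAlgebra A]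

theorem tendsto_nhds_zero_iff_seminorms {ι : Type*} {l : Filter ι} {u : ι → A} :
    Tendsto u l (𝓝 0) ↔ ∀ p : ContCStarSeminorm A, Tendsto (fun i => p (u i)) l (𝓝 0) :=
  ProCStarAlgebra.le_nhds_zero_iff _

theorem eq_zero_of_seminorms_eq_zero {a : A} (h : ∀ p : ContCStarSeminorm A, p a = 0) : a = 0 :=
  tendsto_const_nhds_iff.1 <| (tendsto_nhds_zero_iff_seminorms (l := (atTop : Filter ℕ))).2
    fun p => tendsto_const_nhds_iff.2 (h p)

theorem cauchySeq_of_seminorms {u : ℕ → A} (h : ∀ p : ContCStarSeminorm A,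
    Tendsto (fun m : ℕ × ℕ => p (u m.2 - u m.1)) atTop (𝓝 0)) : CauchySeq u := by
  rw [cauchySeq_iff_tendsto, uniformity_eq_comap_nhds_zero, tendsto_comap_iff]
  exact tendsto_nhds_zero_iff_seminorms.2 h

variable [IsScalarTower ℂ A A] [SMulCommClass ℂ A A] [StarModule ℂ A]

theorem eq_zero_of_star_mul_self_eq_zero {a : A} (h : star a * a = 0) : a = 0 :=
  eq_zero_of_seminorms_eq_zero fun p => by
    rw [← sq_eq_zero_iff, ← p.star_mul_self, h]
    exact map_zero p.toSeminorm

theorem ContCStarSeminorm.exists_character_norm_eq (p : ContCStarSeminorm A)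
    (hcomm : ∀ a b : A, a * b = b * a) (a : A) :
    ∃ χ : A →⋆ₙₐ[ℂ] ℂ, Continuous χ ∧ (∀ b, ‖χ b‖ ≤ p b) ∧ ‖χ a‖ = p a := by
  obtain ⟨χ, hle, heq⟩ := exists_nonUnitalStarAlgHom_norm_eq_seminorm p.toSeminorm p.mul_le
    p.star_mul_self hcomm a
  refine ⟨χ, continuous_of_continuousAt_zero χ ?_, hle, heq⟩
  rw [ContinuousAt, map_zero]
  exact squeeze_zero_norm hle (tendsto_nhds_zero_iff_seminorms.1 tendsto_id p)

theorem eq_zero_of_characters_eq_zero (hcomm : ∀ a b : A, a * b = b * a) {a : A}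
    (h : ∀ χ : A →⋆ₙₐ[ℂ] ℂ, Continuous χ → χ a = 0) : a = 0 :=
  eq_zero_of_seminorms_eq_zero fun p => by
    obtain ⟨χ, hχ, -, heq⟩ := p.exists_character_norm_eq hcomm a
    rw [← heq, h χ hχ, norm_zero]

end ContinuousCharacters

section FunctionalCalculus

open Filter Topology Polynomial

variable {A : Type*} [NonUnitalRing A] [StarRing A] [Module ℂ A] {b : A}

theorem exists_mem_character_eq_eval (J : NonUnitalSubalgebra ℂ A) (hb : IsSelfAdjoint b)
    (hbJ : b ∈ J) (P : ℝ[X]) :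
    ∃ c ∈ J, ∀ χ : A →⋆ₙₐ[ℂ] ℂ, χ c = ((X * P).eval (χ b).re : ℝ) := by
  induction P using Polynomial.induction_on' with
  | add P Q hP hQ =>
    obtain ⟨c, hcJ, hc⟩ := hP
    obtain ⟨d, hdJ, hd⟩ := hQ
    exact ⟨c + d, add_mem hcJ hdJ, fun χ => by
      rw [map_add, hc, hd, mul_add, eval_add, Complex.ofReal_add]⟩
  | monomial n r =>
    induction n with
    | zero =>
      refine ⟨(r : ℂ) • b, SMulMemClass.smul_mem _ hbJ, fun χ => ?_⟩
      rw [map_smul, smul_eq_mul, eval_mul, eval_X, monomial_zero_left, eval_C,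
        Complex.ofReal_mul, ofReal_re_apply_of_isSelfAdjoint χ hb, mul_comm]
    | succ n ih =>
      obtain ⟨c, hcJ, hc⟩ := ih
      refine ⟨c * b, mul_mem hcJ hbJ, fun χ => ?_⟩
      rw [map_mul, hc, ← monomial_mul_X, ← mul_assoc, eval_mul_X, Complex.ofReal_mul,
        ofReal_re_apply_of_isSelfAdjoint χ hb]

theorem exists_mem_norm_character_sub_le (J : NonUnitalSubalgebra ℂ A) (hb : IsSelfAdjoint b)
    (hbJ : b ∈ J) {f : ℝ → ℝ} (hf : Continuous f) (hf0 : f 0 = 0) {r ε : ℝ} (hr : 0 ≤ r)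
    (hε : 0 < ε) :
    ∃ c ∈ J, ∀ χ : A →⋆ₙₐ[ℂ] ℂ, ‖χ b‖ ≤ r → ‖χ c - f (χ b).re‖ ≤ ε := by
  obtain ⟨P, hP⟩ :=
    exists_polynomial_near_of_continuousOn (-r) r f hf.continuousOn (ε / 2) (half_pos hε)
  obtain ⟨c, hcJ, hc⟩ := exists_mem_character_eq_eval J hb hbJ P.divX
  refine ⟨c, hcJ, fun χ hχ => ?_⟩
  set t := (χ b).re
  have hP0 : |P.eval 0 - f 0| < ε / 2 := hP 0 ⟨neg_nonpos.2 hr, hr⟩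
  have hPt : |P.eval t - f t| < ε / 2 :=
    hP t (abs_le.1 ((Complex.abs_re_le_norm _).trans hχ))
  have hdivX : (X * P.divX).eval t = P.eval t - P.eval 0 := by
    rw [eq_sub_iff_add_eq, ← coeff_zero_eq_eval_zero, ← eval_C (x := t) (a := P.coeff 0),
      ← eval_add, X_mul_divX_add]
  calc ‖χ c - f t‖ = |(P.eval t - f t) - (P.eval 0 - f 0)| := by
        rw [hc, hdivX, ← Complex.ofReal_sub, Complex.norm_real, Real.norm_eq_abs, hf0]
        ring_nf
    _ ≤ |P.eval t - f t| + |P.eval 0 - f 0| := abs_sub _ _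
    _ ≤ ε := by linarith

variable [IsScalarTower ℂ A A] [SMulCommClass ℂ A A] [StarModule ℂ A] [UniformSpace A]
  [ProCStarAlgebra A]

theorem exists_mem_character_eq (hcomm : ∀ a b : A, a * b = b * a) {J : NonUnitalSubalgebra ℂ A}
    (hJ : IsClosed (J : Set A)) (hb : IsSelfAdjoint b) (hbJ : b ∈ J) {f : ℝ → ℝ}
    (hf : Continuous f) (hf0 : f 0 = 0) :
    ∃ g ∈ J, ∀ χ : A →⋆ₙₐ[ℂ] ℂ, Continuous χ → χ g = f (χ b).re := by
  choose c hcJ hc using fun n : ℕ => exists_mem_norm_character_sub_le J hb hbJ hf hf0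
    n.cast_nonneg (Nat.one_div_pos_of_nat (α := ℝ) (n := n))
  have hcauchy : CauchySeq c := cauchySeq_of_seminorms fun p => by
    have hlim : Tendsto (fun m : ℕ × ℕ => 1 / ((m.2 : ℝ) + 1) + 1 / ((m.1 : ℝ) + 1))
        atTop (𝓝 0) := by
      rw [← prod_atTop_atTop_eq, ← add_zero (0 : ℝ)]
      exact (tendsto_one_div_add_atTop_nhds_zero_nat.comp tendsto_snd).add
        (tendsto_one_div_add_atTop_nhds_zero_nat.comp tendsto_fst)
    obtain ⟨N, hN⟩ := exists_nat_ge (p b)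
    refine squeeze_zero' (.of_forall fun _ => apply_nonneg p.toSeminorm _) ?_ hlim
    filter_upwards [eventually_ge_atTop (N, N)] with m hm
    obtain ⟨χ, -, hle, heq⟩ := p.exists_character_norm_eq hcomm (c m.2 - c m.1)
    have hχb {k : ℕ} (hk : N ≤ k) : ‖χ b‖ ≤ k := (hle b).trans (hN.trans (Nat.cast_le.2 hk))
    rw [← heq, map_sub, ← sub_sub_sub_cancel_right _ _ ((f (χ b).re : ℝ) : ℂ)]
    exact (norm_sub_le _ _).trans (add_le_add (hc _ χ (hχb hm.2)) (hc _ χ (hχb hm.1)))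
  obtain ⟨g, hg⟩ := cauchySeq_tendsto_of_complete hcauchy
  refine ⟨g, hJ.mem_of_tendsto hg (.of_forall hcJ), fun χ hχ => ?_⟩
  refine tendsto_nhds_unique ((hχ.tendsto g).comp hg) (tendsto_iff_norm_sub_tendsto_zero.2 ?_)
  refine squeeze_zero' (.of_forall fun _ => norm_nonneg _) ?_
    tendsto_one_div_add_atTop_nhds_zero_nat
  filter_upwards [eventually_ge_atTop ⌈‖χ b‖⌉₊] with n hn using hc n χ (Nat.ceil_le.1 hn)

theorem exists_mul_eq_of_isSelfAdjoint (hcomm : ∀ a b : A, a * b = b * a)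
    {J : NonUnitalSubalgebra ℂ A} (hJ : IsClosed (J : Set A)) (hb : IsSelfAdjoint b)
    (hbJ : b ∈ J) :
    ∃ g ∈ J, ∃ h ∈ J, g * h = b ∧
      ∀ χ : A →⋆ₙₐ[ℂ] ℂ, Continuous χ → χ b = 0 → χ g = 0 ∧ χ h = 0 := by
  -- `Real.sqrt` vanishes on the negative reals, so `(√t + √(-t)) * (√t - √(-t)) = t`.
  obtain ⟨g, hgJ, hg⟩ := exists_mem_character_eq hcomm hJ hb hbJ
    (f := fun t => √t + √(-t)) (by fun_prop) (by simp)
  obtain ⟨h, hhJ, hh⟩ := exists_mem_character_eq hcomm hJ hb hbJ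
    (f := fun t => √t - √(-t)) (by fun_prop) (by simp)
  have hsqrt (t : ℝ) : (√t + √(-t)) * (√t - √(-t)) = t := by
    rcases le_total 0 t with ht | ht
    · rw [Real.sqrt_eq_zero_of_nonpos (neg_nonpos.2 ht), add_zero, sub_zero, Real.mul_self_sqrt ht]
    · rw [Real.sqrt_eq_zero_of_nonpos ht, zero_add, zero_sub, mul_neg,
        Real.mul_self_sqrt (neg_nonneg.2 ht), neg_neg]
  refine ⟨g, hgJ, h, hhJ, ?_, fun χ hχ hχb => ⟨?_, ?_⟩⟩
  · refine sub_eq_zero.1 (eq_zero_of_characters_eq_zero hcomm fun χ hχ => ?_)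
    rw [map_sub, map_mul, hg χ hχ, hh χ hχ, ← Complex.ofReal_mul, hsqrt,
      ofReal_re_apply_of_isSelfAdjoint χ hb, sub_self]
  · simp [hg χ hχ, hχb]
  · simp [hh χ hχ, hχb]

end FunctionalCalculus

section Derivations

variable {A : Type*} [NonUnitalRing A] [StarRing A] [Module ℂ A] [IsScalarTower ℂ A A]
  [SMulCommClass ℂ A A] [StarModule ℂ A] [UniformSpace A] [ProCStarAlgebra A]
  {J : NonUnitalStarSubalgebra ℂ A} {d : J →ₗ[ℂ] A}

theorem character_derivation_eq_zero (hcomm : ∀ a b : A, a * b = b * a)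
    (hJ : IsClosed (J : Set A)) (hd : ∀ b c : J, d (b * c) = b * d c + c * d b)
    {b : J} (hb : IsSelfAdjoint b) {χ : A →⋆ₙₐ[ℂ] ℂ} (hχ : Continuous χ) (hχb : χ b = 0) :
    χ (d b) = 0 := by
  obtain ⟨g, hgJ, h, hhJ, hgh, hzero⟩ := exists_mul_eq_of_isSelfAdjoint hcomm
    (J := J.toNonUnitalSubalgebra) hJ (congrArg Subtype.val hb) b.2
  obtain ⟨hχg, hχh⟩ := hzero χ hχ hχb
  rw [show b = (⟨g, hgJ⟩ : J) * ⟨h, hhJ⟩ from Subtype.ext hgh.symm, hd, map_add, map_mul, map_mul,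
    hχg, hχh, zero_mul, zero_mul, add_zero]

theorem derivation_eq_zero_of_isSelfAdjoint (hcomm : ∀ a b : A, a * b = b * a)
    (hJ : IsClosed (J : Set A)) (hd : ∀ b c : J, d (b * c) = b * d c + c * d b)
    {b : J} (hb : IsSelfAdjoint b) : d b = 0 := by
  refine eq_zero_of_characters_eq_zero hcomm fun χ hχ => ?_
  by_cases hχb : χ b = 0
  · exact character_derivation_eq_zero hcomm hJ hd hb hχ hχb
  have hself : IsSelfAdjoint (b * b - χ b • b) := by
    have hχb_star : IsSelfAdjoint (χ b) := (hb.map (NonUnitalStarSubalgebraClass.subtype J)).map χ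
    exact ((hb.commute_iff hb).1 (.refl b)).sub (hχb_star.smul hb)
  have hker : χ (b * b - χ b • b : J) = 0 := by simp
  have hsub := character_derivation_eq_zero hcomm hJ hd hself hχ hker
  rw [map_sub, map_smul, hd, map_sub, map_add, map_mul, map_smul, smul_eq_mul,
    add_sub_cancel_right] at hsub
  exact (mul_eq_zero.1 hsub).resolve_left hχb

theorem derivation_eq_zero (hcomm : ∀ a b : A, a * b = b * a) (hJ : IsClosed (J : Set A))
    (hd : ∀ b c : J, d (b * c) = b * d c + c * d b) : d = 0 := by
  ext b
  rw [← realPart_add_I_smul_imaginaryPart b, map_add, map_smul,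
    derivation_eq_zero_of_isSelfAdjoint hcomm hJ hd (realPart b).2,
    derivation_eq_zero_of_isSelfAdjoint hcomm hJ hd (imaginaryPart b).2, smul_zero, add_zero,
    LinearMap.zero_apply]

end Derivations

section Bimodules

open RightPreHilbertModule LeftPreHilbertModule

/-- A left and right pre-Hilbert module over `A` whose two inner products are compatible and whose
left action is contractive for every continuous C*-seminorm: a Hilbert bimodule without the
completeness requirements and without the bound on the right action. -/
class PreHilbertBimodule (A E : Type*) [NonUnitalRing A] [StarRing A] [Module ℂ A]
    [TopologicalSpace A] [AddCommGroup E] [Module ℂ E] [RightPreHilbertModule A E]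
    [LeftPreHilbertModule A E] : Prop where
  linner_lsmul : ∀ x y z : E, lsmul (linner x y : A) z = rsmul x (rinner y z : A)
  rnorm_lsmul_le : ∀ (p : ContCStarSeminorm A) (a : A) (x : E),
    rnorm p (lsmul a x) ≤ p a * rnorm p x

variable {A E : Type*} [NonUnitalRing A] [StarRing A] [Module ℂ A] [AddCommGroup E] [Module ℂ E]

instance [TopologicalSpace A] [HilbertBimodule A E] : PreHilbertBimodule A E where
  linner_lsmul := HilbertBimodule.linner_lsmul
  rnorm_lsmul_le := HilbertBimodule.rnorm_lsmul_le

variable [RightPreHilbertModule A E]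

theorem rinner_left_ext {x y : E} (h : ∀ z : E, (rinner z x : A) = rinner z y) : x = y := by
  have hsub (z : E) : (rinner z (x - y) : A) = 0 := by
    rw [sub_eq_add_neg, ← neg_one_smul ℂ y, rinner_add, rinner_smul, h, neg_one_smul,
      add_neg_cancel]
  exact sub_eq_zero.1 ((rinner_self_eq_zero _).1 (hsub _))

variable [IsScalarTower ℂ A A] [SMulCommClass ℂ A A] [StarModule ℂ A] [TopologicalSpace A]

theorem mul_theta (T : AdjointableOperators A E) (x y : E) :
    T * theta x y = theta (T.1 x) y := by
  ext z
  exact T.2.1 x (rinner y z)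

theorem theta_mem_compactOperators (x y : E) : theta x y ∈ CompactOperators A E :=
  @subset_closure _ (operatorTopology A E) _ _ (Submodule.subset_span ⟨x, y, rfl⟩)

variable (A E) in
theorem withSeminorms_operatorTopology :
    @WithSeminorms ℂ (AdjointableOperators A E) (ContCStarSeminorm A) _ _ _
      (fun p : ContCStarSeminorm A => opSeminorm p) (operatorTopology A E) :=
  let _ := operatorTopology A E
  ⟨rfl⟩

end Bimodules

section Operators

open RightPreHilbertModule LeftPreHilbertModule

variable {A E : Type*} [NonUnitalRing A] [StarRing A] [Module ℂ A] [IsScalarTower ℂ A A]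
  [SMulCommClass ℂ A A] [StarModule ℂ A] [UniformSpace A] [ProCStarAlgebra A]
  [AddCommGroup E] [Module ℂ E] [RightPreHilbertModule A E]

theorem eq_zero_of_rsmul_rinner_self_eq_zero {x : E} (h : rsmul x (rinner x x : A) = 0) :
    x = 0 := by
  refine (rinner_self_eq_zero (A := A) x).1 (eq_zero_of_star_mul_self_eq_zero ?_)
  rw [star_rinner, ← rinner_rsmul, h, ← zero_smul ℂ (0 : E), rinner_smul, zero_smul]

theorem eq_zero_of_mul_theta_eq_zero {T : AdjointableOperators A E}
    (h : ∀ x y : E, T * theta x y = 0) : T = 0 := by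
  ext x
  refine eq_zero_of_rsmul_rinner_self_eq_zero (A := A) ?_
  have hx := mul_theta T x (T.1 x) ▸ h x (T.1 x)
  exact congrArg (fun S : AdjointableOperators A E => S.1 (T.1 x)) hx

variable [LeftPreHilbertModule A E] [PreHilbertBimodule A E]

theorem rinner_lsmul (a : A) (x y : E) :
    (rinner (lsmul a x) y : A) = rinner x (lsmul (star a) y) := by
  have hmul (w z : E) :
      (rinner w z : A) * rinner (lsmul a x) y = rinner w z * rinner x (lsmul (star a) y) := by
    rw [← rinner_rsmul, ← rinner_rsmul, ← PreHilbertBimodule.linner_lsmul,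
      ← PreHilbertBimodule.linner_lsmul, ← star_linner z (lsmul a x), lsmul_linner, star_mul,
      star_linner, mul_lsmul]
  refine sub_eq_zero.1 (eq_zero_of_star_mul_self_eq_zero ?_)
  rw [star_sub, star_rinner, star_rinner, sub_mul, mul_sub, mul_sub, hmul, hmul, sub_self,
    sub_self, sub_self]

theorem lsmul_rsmul (a b : A) (x : E) : lsmul a (rsmul x b) = rsmul (lsmul a x) b :=
  rinner_left_ext (A := A) fun z => by
    rw [rinner_rsmul, ← star_star a, ← rinner_lsmul, ← rinner_lsmul, rinner_rsmul]

variable (A E) in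
/-- The left action of `A` on `E`, as a homomorphism into the adjointable operators. -/
def lsmulOperator : A →ₙₐ[ℂ] AdjointableOperators A E where
  toFun a :=
    { val := { toFun := lsmul a, map_add' := lsmul_add a, map_smul' := fun c => lsmul_smul c a }
      property := ⟨fun x b => lsmul_rsmul a b x, ⟨lsmul (star a), rinner_lsmul a⟩, fun p =>
        ⟨p a + 1, add_pos_of_nonneg_of_pos (apply_nonneg p.toSeminorm a) one_pos, fun x =>
          (PreHilbertBimodule.rnorm_lsmul_le p a x).trans <|
            mul_le_mul_of_nonneg_right (le_add_of_nonneg_right zero_le_one) (rnorm_nonneg p x)⟩⟩ }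
  map_smul' c a := by ext x; exact smul_lsmul c a x
  map_zero' := by
    ext x
    change lsmul (0 : A) x = 0
    rw [← zero_smul ℂ (0 : A), smul_lsmul, zero_smul]
  map_add' a b := by ext x; exact add_lsmul a b x
  map_mul' a b := by ext x; exact mul_lsmul a b x

theorem lsmulOperator_linner (x y : E) : lsmulOperator A E (linner x y) = theta x y := by
  ext z
  exact PreHilbertBimodule.linner_lsmul x y z

theorem opSeminorm_lsmulOperator_le (p : ContCStarSeminorm A) (a : A) :
    opSeminorm p (lsmulOperator A E a) ≤ p a := by
  rw [opSeminorm_apply]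
  refine csSup_le ⟨_, 0, (rnorm_zero p).le.trans zero_le_one, rfl⟩ ?_
  rintro _ ⟨x, hx, rfl⟩
  exact (PreHilbertBimodule.rnorm_lsmul_le p a x).trans
    (mul_le_of_le_one_right (apply_nonneg p.toSeminorm a) hx)

variable (A E) in
theorem continuous_lsmulOperator :
    @Continuous _ _ _ (operatorTopology A E) (lsmulOperator A E) := by
  let _ := operatorTopology A E
  exact (withSeminorms_operatorTopology A E).continuous_of_continuous_comp
    (LinearMapClass.linearMap (lsmulOperator A E)) fun p =>
      Seminorm.continuous_of_le p.continuous' (opSeminorm_lsmulOperator_le p)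

theorem mul_lsmulOperator_comm (hcomm : ∀ a b : A, a * b = b * a) (T : AdjointableOperators A E)
    (a : A) : T * lsmulOperator A E a = lsmulOperator A E a * T := by
  refine sub_eq_zero.1 (eq_zero_of_mul_theta_eq_zero fun x y => ?_)
  rw [sub_mul, sub_eq_zero]
  calc T * lsmulOperator A E a * theta x y
      = T * theta x y * lsmulOperator A E a := by
        rw [mul_assoc, mul_assoc, ← lsmulOperator_linner, ← map_mul, hcomm, map_mul]
    _ = lsmulOperator A E a * T * theta x y := by
        rw [mul_assoc _ T, mul_theta, ← lsmulOperator_linner, ← map_mul, hcomm, map_mul]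

variable (A E) in
/-- The elements of `A` that, together with their adjoints, act on `E` from the left by compact
operators. -/
def compactlyActing : NonUnitalStarSubalgebra ℂ A :=
  let S := (CompactOperators A E).comap (lsmulOperator A E)
  { S ⊓ star S with
    star_mem' := fun ha => ⟨ha.2, by
      rw [SetLike.mem_coe, NonUnitalSubalgebra.mem_star_iff, star_star]; exact ha.1⟩ }

theorem isClosed_compactlyActing : IsClosed (compactlyActing A E : Set A) := by
  let _ := operatorTopology A E
  have hK : IsClosed {a | lsmulOperator A E a ∈ CompactOperators A E} :=
    isClosed_closure.preimage (continuous_lsmulOperator A E)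
  exact hK.inter (hK.preimage continuous_star)

theorem linner_mem_compactlyActing (x y : E) : (linner x y : A) ∈ compactlyActing A E := by
  refine ⟨?_, ?_⟩
  · change lsmulOperator A E (linner x y) ∈ CompactOperators A E
    rw [lsmulOperator_linner]
    exact theta_mem_compactOperators x y
  · change lsmulOperator A E (star (linner x y)) ∈ CompactOperators A E
    rw [star_linner, lsmulOperator_linner]
    exact theta_mem_compactOperators y x

variable (A E) in
/-- The left action on `E` of the elements acting compactly, as a homomorphism into the compact
operators. -/
def lsmulCompactOperator : compactlyActing A E →ₙₐ[ℂ] CompactOperators A E :=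
  NonUnitalAlgHom.codRestrict
    ((lsmulOperator A E).comp (NonUnitalSubalgebraClass.subtype (compactlyActing A E)))
    (CompactOperators A E) fun a => a.2.1

/-- The matrix coefficient `T ↦ _A⟨T u, v⟩` on the adjointable operators. -/
def matrixCoefficient (u v : E) : AdjointableOperators A E →ₗ[ℂ] A where
  toFun T := linner (T.1 u) v
  map_add' _ _ := add_linner _ _ _
  map_smul' _ _ := smul_linner _ _ _

/-- The matrix coefficient `b ↦ _A⟨D(L_b) u, v⟩` of a linear map `D` on the compact operators,
where `L_b` is the left action of `b`. -/
def lsmulCoefficient (D : CompactOperators A E →ₗ[ℂ] CompactOperators A E) (u v : E) :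
    compactlyActing A E →ₗ[ℂ] A :=
  matrixCoefficient u v ∘ₗ (CompactOperators A E).toSubmodule.subtype ∘ₗ D ∘ₗ
    LinearMapClass.linearMap (lsmulCompactOperator A E)

end Operators

section CompactDerivations

open RightPreHilbertModule LeftPreHilbertModule

variable {A E : Type*} [NonUnitalRing A] [StarRing A] [Module ℂ A] [IsScalarTower ℂ A A]
  [SMulCommClass ℂ A A] [StarModule ℂ A] [UniformSpace A] [ProCStarAlgebra A]
  [AddCommGroup E] [Module ℂ E] [RightPreHilbertModule A E] [LeftPreHilbertModule A E]
  [PreHilbertBimodule A E] {D : CompactOperators A E →ₗ[ℂ] CompactOperators A E}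

theorem IsDerivation.lsmulCoefficient_mul (hD : IsDerivation D) (hcomm : ∀ a b : A, a * b = b * a)
    (u v : E) (b c : compactlyActing A E) :
    lsmulCoefficient D u v (b * c) =
      b * lsmulCoefficient D u v c + c * lsmulCoefficient D u v b := by
  let L := lsmulCompactOperator A E
  have hcommL (T : CompactOperators A E) : T * L c = L c * T :=
    Subtype.ext (mul_lsmulOperator_comm hcomm T.1 c.1)
  have hDmul : D (L (b * c)) = L b * D (L c) + L c * D (L b) := by
    rw [map_mul, hD, hcommL, add_comm]
  calc lsmulCoefficient D u v (b * c)
      = linner (lsmul b.1 ((D (L c)).1.1 u) + lsmul c.1 ((D (L b)).1.1 u)) v :=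
        congrArg (fun T : CompactOperators A E => linner (T.1.1 u) v) hDmul
    _ = b * lsmulCoefficient D u v c + c * lsmulCoefficient D u v b := by
        rw [add_linner, lsmul_linner, lsmul_linner]
        rfl

theorem IsDerivation.apply_lsmulCompactOperator (hD : IsDerivation D)
    (hcomm : ∀ a b : A, a * b = b * a) (b : compactlyActing A E) :
    D (lsmulCompactOperator A E b) = 0 := by
  refine Subtype.ext (Subtype.ext (LinearMap.ext fun u => ?_))
  have hcoeff := derivation_eq_zero hcomm isClosed_compactlyActing
    (hD.lsmulCoefficient_mul hcomm u ((D (lsmulCompactOperator A E b)).1.1 u))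
  exact (linner_self_eq_zero (A := A) _).1 (LinearMap.congr_fun hcoeff b)

theorem IsDerivation.apply_theta (hD : IsDerivation D) (hcomm : ∀ a b : A, a * b = b * a)
    (x y : E) : D ⟨theta x y, theta_mem_compactOperators x y⟩ = 0 := by
  rw [← hD.apply_lsmulCompactOperator hcomm ⟨linner x y, linner_mem_compactlyActing x y⟩]
  exact congrArg D (Subtype.ext (lsmulOperator_linner x y).symm)

end CompactDerivations

end ProCStar

open ProCStar in
theorem mainTheorem2_general {A E : Type*}
    [NonUnitalRing A] [StarRing A] [Module ℂ A] [IsScalarTower ℂ A A] [SMulCommClass ℂ A A]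
    [StarModule ℂ A] [UniformSpace A] [ProCStarAlgebra A]
    [AddCommGroup E] [Module ℂ E] [RightPreHilbertModule A E] [LeftPreHilbertModule A E]
    [PreHilbertBimodule A E] (hcomm : ∀ a b : A, a * b = b * a)
    (D : CompactOperators A E →ₗ[ℂ] CompactOperators A E) (hD : IsDerivation D) :
    D = 0 := by
  refine LinearMap.ext fun T => Subtype.ext (eq_zero_of_mul_theta_eq_zero fun x y => ?_)
  let Θ (z : E) : CompactOperators A E := ⟨theta z y, theta_mem_compactOperators z y⟩
  have hDΘ (z : E) : D (Θ z) = 0 := hD.apply_theta hcomm z y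
  have hTΘ : T * Θ x = Θ (T.1.1 x) := Subtype.ext (mul_theta T.1 x y)
  have hDT : D T * Θ x = 0 := by
    have hDTΘ := hD T (Θ x)
    rw [hTΘ, hDΘ, hDΘ, mul_zero, add_zero] at hDTΘ
    exact hDTΘ.symm
  exact congrArg Subtype.val hDT

theorem mainTheorem2 {A E : Type*}
    [NonUnitalRing A] [StarRing A] [Module ℂ A] [IsScalarTower ℂ A A] [SMulCommClass ℂ A A]
    [StarModule ℂ A] [UniformSpace A] [ProCStar.ProCStarAlgebra A]
    [AddCommGroup E] [Module ℂ E] [ProCStar.HilbertBimodule A E]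
    (hcomm : ∀ a b : A, a * b = b * a)
    (D : ProCStar.CompactOperators A E →ₗ[ℂ] ProCStar.CompactOperators A E)
    (hD : ProCStar.IsDerivation D) :
    D = 0 :=
  mainTheorem2_general hcomm D hD
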